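/- Let $M$ be a lattice (a free $\mathbb{Z}$-module of finite rank), let $Q \subset M \otimes \mathbb{R}$ be a (nonempty) lattice polytope, i.e. the convex hull of a nonempty finite set of points of $M$, and let $\lambda : M \to \mathbb{Z}$ be a linear form, extended $\mathbb{R}$-linearly to $M \otimes \mathbb{R}$. Assume: - (Positivity) $\lambda(x) \geq 0$ for every vertex $x$ of $Q$; - (Genericity) $\lambda(x) \neq \lambda(y)$ for every edge of $Q$ with end points $x, y$. Let $q$ and $t$ be indeterminates. For $n \geq 0$ put $W_\lambda(nQ,q) = \sum_{x \in nQ \cap M} q^{\lambda(x)} \in \mathbb{Z}[q]$, where $nQ$ is the dilate of $Q$ by $n$, and let $$\operatorname{Ehr}_{Q,\lambda}(t,q) = \sum_{n \geq 0} W_\lambda(nQ,q)\, t^n \in \mathbb{Z}[q][[t]].$$ Then $\operatorname{Ehr}_{Q,\lambda}$ is a rational function in $t$ and $q$ whose denominator is a product, without multiplicities, of factors $1 - t q^j$ with $0 \leq j \leq \max_Q \lambda$, and the factor with index $j$ can appear only if $j = \lambda(v)$ for some vertex $v$ of $Q$. Precisely: there are a finite set $S$ of nonnegative integers and a polynomial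 $P \in \mathbb{Z}[q][t]$, relatively prime to $\prod_{j \in S} (1 - t q^j)$ in $\mathbb{Z}[q][t]$, such that $$\operatorname{Ehr}_{Q,\lambda}(t,q) \cdot \prod_{j \in S} (1 - t q^j) = P(t,q) \quad \text{in } \mathbb{Z}[q][[t]],$$ and every $j \in S$ satisfies $j \leq \max_Q \lambda$ and $j = \lambda(v)$ for some vertex $v$ of $Q$. -/

import Mathlib

open scoped TensorProduct Pointwise Polynomial

namespace QEhrhart

section

variable {M : Type*} [AddCommGroup M]

/-- The inclusion `m ↦ 1 ⊗ m` of the lattice `M` into its ambient real vector space `ℝ ⊗[ℤ] M`. -/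
noncomputable def latticeIncl (M : Type*) [AddCommGroup M] : M →+ ℝ ⊗[ℤ] M :=
  (TensorProduct.mk ℤ ℝ M 1).toAddMonoidHom

/-- The `ℝ`-linear extension `r ⊗ m ↦ r * l m` of an integral linear form `l` on `M`. -/
noncomputable def realForm (l : Module.Dual ℤ M) : ℝ ⊗[ℤ] M →ₗ[ℝ] ℝ :=
  Module.Dual.baseChange ℝ l

/-- A (nonempty) lattice polytope: the convex hull of a nonempty finite set of lattice points. -/
def IsLatticePolytope (Q : Set (ℝ ⊗[ℤ] M)) : Prop :=
  ∃ V : Finset M, V.Nonempty ∧ Q = convexHull ℝ (latticeIncl M '' (V : Set M))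

/-- The segment from `x` to `y` is an edge (a one-dimensional face) of `Q`. -/
def IsEdge (Q : Set (ℝ ⊗[ℤ] M)) (x y : ℝ ⊗[ℤ] M) : Prop :=
  x ≠ y ∧ IsExtreme ℝ Q (segment ℝ x y)

/-- Positivity: the linear form is nonnegative on the vertices of `Q`. -/
def Positivity (Q : Set (ℝ ⊗[ℤ] M)) (l : Module.Dual ℤ M) : Prop :=
  ∀ v ∈ Q.extremePoints ℝ, 0 ≤ realForm l v

/-- Genericity: the linear form takes different values at the two ends of every edge of `Q`. -/
def Genericity (Q : Set (ℝ ⊗[ℤ] M)) (l : Module.Dual ℤ M) : Prop :=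
  ∀ x y, IsEdge Q x y → realForm l x ≠ realForm l y

/-- The lattice points of a subset `A` of the ambient space. -/
def latticePoints (A : Set (ℝ ⊗[ℤ] M)) : Set M :=
  {m | latticeIncl M m ∈ A}

/-- The weighted sum of `q ^ l x` over the lattice points `x` of `A`, a polynomial in `q = X`.
The set of lattice points is finite and the exponents `l x` are nonnegative when `A` is a dilate of
a lattice polytope satisfying positivity: see `latticePoints_finite` and `nonneg_of_mem` below. -/
noncomputable def weightedSum (l : Module.Dual ℤ M) (A : Set (ℝ ⊗[ℤ] M)) : ℤ[X] :=
  ∑ᶠ x ∈ latticePoints A, Polynomial.X ^ (l x).toNat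

/-- The `q`-Ehrhart series `∑ₙ W(nQ, q) tⁿ`, a power series in `t` over `ℤ[q]`. -/
noncomputable def ehrhartSeries (Q : Set (ℝ ⊗[ℤ] M)) (l : Module.Dual ℤ M) : PowerSeries ℤ[X] :=
  PowerSeries.mk fun n => weightedSum l ((n : ℝ) • Q)

/-- The product of the factors `1 - t q ^ j` for `j ∈ S`, in `ℤ[q][t]`. -/
noncomputable def denominator (S : Finset ℕ) : ℤ[X][X] :=
  ∏ j ∈ S, (1 - Polynomial.X * Polynomial.C (Polynomial.X ^ j))

@[simp] theorem realForm_latticeIncl (l : Module.Dual ℤ M) (m : M) :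
    realForm l (latticeIncl M m) = l m := by
  change Module.Dual.baseChange ℝ l ((1 : ℝ) ⊗ₜ[ℤ] m) = l m
  rw [Module.Dual.baseChange_apply_tmul]
  simp

theorem bounded_on_polytope {Q : Set (ℝ ⊗[ℤ] M)} (hQ : IsLatticePolytope Q)
    (f : ℝ ⊗[ℤ] M →ₗ[ℝ] ℝ) : ∃ B : ℝ, ∀ x ∈ Q, |f x| ≤ B := by
  obtain ⟨V, -, rfl⟩ := hQ
  refine ⟨∑ v ∈ V, |f (latticeIncl M v)|, fun x hx => ?_⟩
  have hc : Convex ℝ (f ⁻¹' Set.Icc (-∑ v ∈ V, |f (latticeIncl M v)|)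
      (∑ v ∈ V, |f (latticeIncl M v)|)) := (convex_Icc _ _).linear_preimage f
  refine abs_le.mpr (convexHull_min ?_ hc hx)
  rintro _ ⟨v, hv, rfl⟩
  exact abs_le.mp (Finset.single_le_sum (f := fun v => |f (latticeIncl M v)|)
    (fun _ _ => abs_nonneg _) hv)

/-- A dilate of a lattice polytope contains finitely many lattice points. -/
theorem latticePoints_finite [Module.Free ℤ M] [Module.Finite ℤ M] {Q : Set (ℝ ⊗[ℤ] M)}
    (hQ : IsLatticePolytope Q) (c : ℝ) : (latticePoints (c • Q)).Finite := by
  let b := Module.Free.chooseBasis ℤ M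
  choose B hB using fun i => bounded_on_polytope hQ (realForm (b.coord i))
  have hfin : (Set.pi Set.univ fun i => Set.Icc (-⌈|c| * B i⌉) ⌈|c| * B i⌉).Finite :=
    Set.Finite.pi fun i => Set.finite_Icc _ _
  refine Set.Finite.of_finite_image (f := b.equivFun) (hfin.subset ?_) b.equivFun.injective.injOn
  rintro _ ⟨m, ⟨x, hx, hxm⟩, rfl⟩ i -
  have h1 : realForm (b.coord i) (latticeIncl M m) = (b.coord i m : ℝ) := realForm_latticeIncl _ _
  have h2 : |(b.coord i m : ℝ)| ≤ |c| * B i := by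
    rw [← h1, ← hxm]
    simp only [map_smul, smul_eq_mul, abs_mul]
    exact mul_le_mul_of_nonneg_left (hB i x hx) (abs_nonneg c)
  have h3 : |b.coord i m| ≤ ⌈|c| * B i⌉ := by
    have := h2.trans (Int.le_ceil _)
    exact_mod_cast this
  simpa using abs_le.mp h3

/-- The convex hull of a finite set is the convex hull of its extreme points. -/
theorem convexHull_subset_convexHull_extremePoints {E : Type*} [AddCommGroup E] [Module ℝ E]
    (V : Finset E) : convexHull ℝ (V : Set E) ⊆
      convexHull ℝ ((convexHull ℝ (V : Set E)).extremePoints ℝ) := by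
  classical
  induction h : V.card using Nat.strong_induction_on generalizing V with
  | _ k ih =>
    subst h
    by_cases hred : ∃ v ∈ V, v ∈ convexHull ℝ ((V.erase v : Finset E) : Set E)
    · obtain ⟨v, hv, hvm⟩ := hred
      have heq : convexHull ℝ ((V.erase v : Finset E) : Set E) = convexHull ℝ (V : Set E) := by
        refine (convexHull_mono (Finset.coe_subset.mpr (Finset.erase_subset _ _))).antisymm
          (convexHull_min (fun w hw => ?_) (convex_convexHull _ _))
        by_cases hwv : w = v
        · exact hwv ▸ hvm
        · exact subset_convexHull _ _ (by simpa [hwv] using hw)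
      have := ih _ (Finset.card_erase_lt_of_mem hv) (V.erase v) rfl
      rwa [heq] at this
    · push Not at hred
      refine convexHull_mono fun v hv => ⟨subset_convexHull _ _ hv, ?_⟩
      intro x₁ hx₁ x₂ hx₂ hvx
      have hins : (V : Set E) = insert v ((V.erase v : Finset E) : Set E) := by
        rw [← Finset.coe_insert, Finset.insert_erase hv]
      rcases ((V.erase v : Finset E) : Set E).eq_empty_or_nonempty with he | hne
      · rw [hins, he] at hx₁
        simpa using hx₁
      rw [hins, convexHull_insert hne, mem_convexJoin] at hx₁ hx₂
      obtain ⟨_, rfl, y₁, hy₁, c₁, d₁, hc₁, hd₁, hcd₁, rfl⟩ := hx₁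
      obtain ⟨_, rfl, y₂, hy₂, c₂, d₂, hc₂, hd₂, hcd₂, rfl⟩ := hx₂
      obtain ⟨a, b, ha, hb, hab, hv'⟩ := hvx
      rename_i v
      by_cases hz : a * d₁ + b * d₂ = 0
      · have h1 : 0 ≤ a * d₁ := by positivity
        have h2 : 0 ≤ b * d₂ := by positivity
        have hd : d₁ = 0 := by
          rcases mul_eq_zero.mp (show a * d₁ = 0 by linarith) with h | h
          · exact absurd h ha.ne'
          · exact h
        have hc : c₁ = 1 := by linarith
        simp [hd, hc]
      · exfalso
        have hpos : 0 < a * d₁ + b * d₂ := lt_of_le_of_ne (by positivity) (Ne.symm hz)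
        refine hred v hv ?_
        have hmem := (convex_convexHull ℝ ((V.erase v : Finset E) : Set E)) hy₁ hy₂
          (a := a * d₁ / (a * d₁ + b * d₂)) (b := b * d₂ / (a * d₁ + b * d₂))
          (by positivity) (by positivity) (by field_simp)
        convert hmem using 1
        have h3 : (a * d₁ + b * d₂) • v = (a * d₁) • y₁ + (b * d₂) • y₂ := by
          have h4 : a * d₁ + b * d₂ = 1 - a * c₁ - b * c₂ := by
            rw [show d₁ = 1 - c₁ by linarith, show d₂ = 1 - c₂ by linarith]
            linear_combination hab
          rw [h4, sub_smul, sub_smul, one_smul]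
          nth_rewrite 1 [← hv']
          module
        rw [div_eq_inv_mul, div_eq_inv_mul, mul_smul _ (a * d₁), mul_smul _ (b * d₂), ← smul_add, ← h3, smul_smul,
          inv_mul_cancel₀ hz, one_smul]

/-- Under positivity, the linear form is nonnegative on the lattice points of the dilates. -/
theorem nonneg_of_mem {Q : Set (ℝ ⊗[ℤ] M)} (hQ : IsLatticePolytope Q) {l : Module.Dual ℤ M}
    (hpos : Positivity Q l) (n : ℕ) {m : M} (hm : m ∈ latticePoints ((n : ℝ) • Q)) : 0 ≤ l m := by
  classical
  obtain ⟨V, -, rfl⟩ := hQ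
  obtain ⟨x, hx, hxm⟩ := hm
  have key := convexHull_subset_convexHull_extremePoints (V.image (latticeIncl M))
  rw [Finset.coe_image] at key
  have hc : Convex ℝ (realForm l ⁻¹' Set.Ici 0) := (convex_Ici _).linear_preimage _
  have h0 : 0 ≤ realForm l x := convexHull_min hpos hc (key hx)
  have h1 : (0 : ℝ) ≤ (l m : ℝ) := by
    rw [← realForm_latticeIncl, ← hxm]
    simp only [map_smul, smul_eq_mul]
    positivity
  exact_mod_cast h1

end

end QEhrhart

/-! Refine the series to `multiSeries`, E = ∑ₙ ∑_{x ∈ nQ ∩ M} x tⁿ over the group ring ℤ[M]. The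
cone over Q is generated by the (v, 1) for v a vertex, so Gordan's lemma makes E · ∏ (1 - x^v t) a
polynomial N (`exists_multiSeries_mul_eq`). Over the domain ℤ[M] the poles t = x^(-v) are distinct,
hence simple.

The residue at x^(-v) is the limit of the translated dilates nQ - nv, that is, the generating
function of the tangent cone at v (`act_prod_eq_eval`, `eventually_mem_dilate_iff`). That cone is
generated by edge directions h, so the residue has denominator p_v = ∏ (1 - x^h)
(`exists_act_tangent_cone_eq`), which genericity keeps nonzero under x ↦ q^(l x).

Multiplied by ∏ p_v, the partial fraction decomposition of E therefore survives the specialization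
(`exists_partial_fractions`). Poles with equal l v merge, but a sum of simple poles at one point is
still a simple pole (`exists_mul_prod_image_eq`). The auxiliary factor ∏ p_v does not involve t and
is nonzero, so it does not affect which coefficients in t vanish. Finally common factors are
cancelled (`exists_reduced_fraction`). -/

namespace QEhrhart

/-! ### Generating functions of finitely generated sets, as functions acted on by the group ring. -/

section GroupRing

variable {L : Type*} [AddCommGroup L]

/-- The group ring `ℤ[L]` acts on functions `L → ℤ` by translations. -/
noncomputable def act : AddMonoidAlgebra ℤ L →ₐ[ℤ] Module.End ℤ (L → ℤ) :=
  AddMonoidAlgebra.lift ℤ (Module.End ℤ (L → ℤ)) L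
    { toFun := fun g => LinearMap.funLeft ℤ ℤ fun m => m - g.toAdd
      map_one' := by ext; simp [LinearMap.funLeft]
      map_mul' := fun g h => by
        apply LinearMap.ext
        intro f
        funext m
        simp only [LinearMap.funLeft_apply, toAdd_mul, Module.End.mul_apply]
        congr 1
        abel }

theorem act_single (g : L) (r : ℤ) (f : L → ℤ) (m : L) :
    act (AddMonoidAlgebra.single g r) f m = r * f (m - g) := by
  simp [act, AddMonoidAlgebra.lift_single, LinearMap.funLeft_apply]

/-- The binomial `1 - x ^ g` of the group ring. -/
noncomputable def binom (g : L) : AddMonoidAlgebra ℤ L :=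
  1 - AddMonoidAlgebra.single g 1

theorem act_binom (g : L) (f : L → ℤ) (m : L) : act (binom g) f m = f m - f (m - g) := by
  simp [binom, act_single]

theorem act_mul_apply (a b : AddMonoidAlgebra ℤ L) (f : L → ℤ) :
    act (a * b) f = act a (act b f) := by
  rw [map_mul, Module.End.mul_apply]

/-- On finitely supported functions the action is multiplication in ℤ[L]; this brings identities
between functions back to the ring, where cancellation is available. -/
theorem act_coeff (a b : AddMonoidAlgebra ℤ L) : act a ⇑b.coeff = ⇑(a * b).coeff := by
  induction a using AddMonoidAlgebra.induction_linear with
  | zero => ext; simp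
  | add x y hx hy =>
    rw [map_add, LinearMap.add_apply, hx, hy, add_mul]
    rfl
  | single g r =>
    ext m
    rw [act_single, AddMonoidAlgebra.coeff_single_mul_apply]
    congr 2
    abel

theorem range_sum_smul_eq_closure (G : Finset L) (x : L) :
    x ∈ AddSubmonoid.closure (G : Set L) ↔ ∃ a : G → ℕ, ∑ g, a g • (g : L) = x := by
  classical
  constructor
  · intro hx
    induction hx using AddSubmonoid.closure_induction with
    | mem y hy =>
      exact ⟨Pi.single ⟨y, hy⟩ 1, by simp [Pi.single_apply, ite_smul]⟩
    | zero => exact ⟨0, by simp⟩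
    | add y z _ _ hy hz =>
      obtain ⟨a, rfl⟩ := hy
      obtain ⟨b, rfl⟩ := hz
      exact ⟨a + b, by simp [add_smul, Finset.sum_add_distrib]⟩
  · rintro ⟨a, rfl⟩
    exact sum_mem fun g _ => AddSubmonoid.nsmul_mem _ (AddSubmonoid.subset_closure g.2) _

/-- Subsets of a finitely generated set that are stable under the monoid are finitely generated. -/
theorem exists_eq_add_closure (G F : Finset L) (B : Set L)
    (hB : B ⊆ (F : Set L) + AddSubmonoid.closure (G : Set L))
    (hst : ∀ b ∈ B, ∀ s ∈ AddSubmonoid.closure (G : Set L), b + s ∈ B) :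
    ∃ F' : Finset L, B = (F' : Set L) + AddSubmonoid.closure (G : Set L) := by
  classical
  let U : L → Set (G → ℕ) := fun f => {a | f + ∑ g, a g • (g : L) ∈ B}
  -- Dickson's lemma: ℕ^G is well-quasi-ordered, so the antichain of minimal exponents is finite.
  have hfin : ∀ f, {a | Minimal (· ∈ U f) a}.Finite := fun f =>
    (setOfPred_minimal_antichain _).finite_of_partiallyWellOrderedOn
      (Set.isPWO_of_wellQuasiOrderedLE _)
  have hF : (⋃ f ∈ F, (fun a : G → ℕ => f + ∑ g, a g • (g : L)) ''
      {a | Minimal (· ∈ U f) a}).Finite :=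
    F.finite_toSet.biUnion fun f _ => (hfin f).image _
  refine ⟨hF.toFinset, ?_⟩
  rw [Set.Finite.coe_toFinset]
  ext x
  simp only [Set.mem_add, Set.mem_iUnion, Set.mem_image, SetLike.mem_coe]
  constructor
  · intro hx
    obtain ⟨f, hf, s, hs, rfl⟩ := hB hx
    obtain ⟨a, rfl⟩ := (range_sum_smul_eq_closure G s).1 hs
    obtain ⟨z, hz, hmin⟩ :=
      (Set.isPWO_of_wellQuasiOrderedLE (U f)).exists_le_minimal (a := a) hx
    refine ⟨_, ⟨f, hf, z, hmin, rfl⟩, ∑ g, (a - z) g • (g : L),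
      (range_sum_smul_eq_closure G _).2 ⟨_, rfl⟩, ?_⟩
    rw [add_assoc, ← Finset.sum_add_distrib]
    congr 1
    refine Finset.sum_congr rfl fun g _ => ?_
    rw [← add_smul, Pi.sub_apply, add_tsub_cancel_of_le (hz g)]
  · rintro ⟨_, ⟨f, -, a, ha, rfl⟩, s, hs, rfl⟩
    exact hst _ ha.1 s hs

theorem mem_closure_insert_iff [DecidableEq L] (e : L) (G : Finset L) (x : L) :
    x ∈ AddSubmonoid.closure ((insert e G : Finset L) : Set L) ↔
      x ∈ AddSubmonoid.closure (G : Set L) ∨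
      x - e ∈ AddSubmonoid.closure ((insert e G : Finset L) : Set L) := by
  have he : e ∈ AddSubmonoid.closure ((insert e G : Finset L) : Set L) :=
    AddSubmonoid.subset_closure (by simp)
  have hle : AddSubmonoid.closure (G : Set L) ≤
      AddSubmonoid.closure ((insert e G : Finset L) : Set L) :=
    AddSubmonoid.closure_mono (by simp)
  constructor
  · intro hx
    rw [Finset.coe_insert, Set.insert_eq, AddSubmonoid.closure_union, AddSubmonoid.mem_sup] at hx
    obtain ⟨y, hy, z, hz, rfl⟩ := hx
    obtain ⟨n, rfl⟩ := AddSubmonoid.mem_closure_singleton.1 hy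
    rcases n with _ | n
    · left
      simpa using hz
    · right
      have : (n + 1) • e + z - e = n • e + z := by rw [add_smul, one_smul]; abel
      rw [this]
      exact add_mem (nsmul_mem he n) (hle hz)
  · rintro (h | h)
    · exact hle h
    · simpa using add_mem h he

/-- The generating function of a finitely generated set is a rational function with denominator the
product of the binomials attached to the generators. -/
theorem exists_act_prod_binom_eq (G F : Finset L) :
    ∃ b : AddMonoidAlgebra ℤ L, act (∏ g ∈ G, binom g)
      (Set.indicator ((F : Set L) + AddSubmonoid.closure (G : Set L)) 1) = ⇑b.coeff := by
  classical
  induction G using Finset.induction_on generalizing F with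
  | empty =>
    refine ⟨∑ f ∈ F, AddMonoidAlgebra.single f 1, ?_⟩
    ext m
    simp [AddMonoidAlgebra.coeff_sum, Finsupp.finsetSum_apply, Set.indicator_apply,
      Finsupp.single_apply]
  | insert e G he ih =>
    set A : Set L := (F : Set L) + AddSubmonoid.closure ((insert e G : Finset L) : Set L)
      with hA
    set A' : Set L := (F : Set L) + AddSubmonoid.closure (G : Set L) with hA'
    have hmem : ∀ m, m ∈ A ↔ m ∈ A' ∨ m - e ∈ A := by
      intro m
      simp only [hA, hA', Set.mem_add, SetLike.mem_coe]
      constructor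
      · rintro ⟨f, hf, s, hs, rfl⟩
        rcases (mem_closure_insert_iff e G s).1 hs with h | h
        · exact Or.inl ⟨f, hf, s, h, rfl⟩
        · exact Or.inr ⟨f, hf, _, h, by abel⟩
      · rintro (⟨f, hf, s, hs, rfl⟩ | ⟨f, hf, s, hs, h⟩)
        · exact ⟨f, hf, s, (mem_closure_insert_iff e G s).2 (Or.inl hs), rfl⟩
        · refine ⟨f, hf, s + e, (mem_closure_insert_iff e G _).2 (Or.inr (by simpa using hs)), ?_⟩
          rw [← add_assoc, h, sub_add_cancel]
    have hstA : ∀ b ∈ A, ∀ s ∈ AddSubmonoid.closure (G : Set L), b + s ∈ A := by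
      rintro _ ⟨f, hf, t, ht, rfl⟩ s hs
      refine ⟨f, hf, t + s, add_mem ht ?_, (add_assoc _ _ _).symm⟩
      exact AddSubmonoid.closure_mono (by simp) hs
    have hstA' : ∀ b ∈ A', ∀ s ∈ AddSubmonoid.closure (G : Set L), b + s ∈ A' := by
      rintro _ ⟨f, hf, t, ht, rfl⟩ s hs
      exact ⟨f, hf, t + s, add_mem ht hs, (add_assoc _ _ _).symm⟩
    -- The overlap A' ∩ (A + e) is again finitely generated over the smaller monoid, with new
    -- translates F'; hence the induction over all F.
    obtain ⟨F', hF'⟩ := exists_eq_add_closure G F (A' ∩ {m | m - e ∈ A})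
      Set.inter_subset_left (fun b hb s hs => ⟨hstA' b hb.1 s hs, by
        have := hstA _ hb.2 s hs
        rwa [sub_add_eq_add_sub] at this⟩)
    obtain ⟨b₁, hb₁⟩ := ih F
    obtain ⟨b₂, hb₂⟩ := ih F'
    refine ⟨b₁ - b₂, ?_⟩
    -- Since A = A' ∪ (A + e), subtracting the indicator of A + e from that of A leaves A' minus the
    -- overlap.
    have hstep : act (binom e) (Set.indicator A 1) =
        Set.indicator A' 1 - Set.indicator (A' ∩ {m | m - e ∈ A}) (1 : L → ℤ) := by
      ext m
      have := hmem m
      rw [act_binom]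
      simp only [Pi.sub_apply, Set.indicator_apply, Set.mem_inter_iff, Set.mem_ofPred_eq,
        Pi.one_apply]
      by_cases h1 : m ∈ A' <;> by_cases h2 : m - e ∈ A <;> simp [this, h1, h2]
    rw [Finset.prod_insert he, mul_comm, act_mul_apply, hstep, map_sub, hb₁, hF', hb₂]
    rfl

end GroupRing

/-! ### Series over the group ring, residues at the poles t = x^(-v), partial fractions. -/

section Series

open PowerSeries Filter

variable {M : Type*} [AddCommGroup M]

theorem twoUniqueSums_of_free (M : Type*) [AddCommGroup M] [Module.Free ℤ M] :
    TwoUniqueSums M :=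
  TwoUniqueSums.of_injective_addHom
    ((Module.Free.chooseBasis ℤ M).repr.toLinearMap.toAddMonoidHom.toAddHom)
    (Module.Free.chooseBasis ℤ M).repr.injective inferInstance

theorem isDomain_groupRing (M : Type*) [AddCommGroup M] [Module.Free ℤ M] :
    IsDomain (AddMonoidAlgebra ℤ M) := by
  have := twoUniqueSums_of_free M
  have : NoZeroDivisors (AddMonoidAlgebra ℤ M) := inferInstance
  exact NoZeroDivisors.to_isDomain _

/-- The factor `1 - x ^ v t` in `ℤ[M][t]`. -/
noncomputable def fac (v : M) : (AddMonoidAlgebra ℤ M)[X] :=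
  1 - Polynomial.C (AddMonoidAlgebra.single v 1) * Polynomial.X

theorem coeff_zero_mul_fac (E : PowerSeries (AddMonoidAlgebra ℤ M)) (v : M) :
    coeff 0 (E * (fac v : PowerSeries (AddMonoidAlgebra ℤ M))) = coeff 0 E := by
  simp [fac, mul_sub]

theorem coeff_succ_mul_fac (E : PowerSeries (AddMonoidAlgebra ℤ M)) (v : M) (n : ℕ) :
    coeff (n + 1) (E * (fac v : PowerSeries (AddMonoidAlgebra ℤ M))) =
      coeff (n + 1) E - AddMonoidAlgebra.single v 1 * coeff n E := by
  have : E * (fac v : PowerSeries (AddMonoidAlgebra ℤ M)) =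
      E - PowerSeries.C (AddMonoidAlgebra.single v 1) * (E * X) := by
    simp only [fac, Polynomial.coe_sub, Polynomial.coe_one, Polynomial.coe_mul, Polynomial.coe_C,
      Polynomial.coe_X]
    ring
  rw [this, map_sub, coeff_C_mul, coeff_succ_mul_X]

/-- The coefficients of a series over `ℤ[M]`, as a function on `M × ℤ`. -/
noncomputable def coeffFun (E : PowerSeries (AddMonoidAlgebra ℤ M)) : M × ℤ → ℤ :=
  fun p => if 0 ≤ p.2 then (coeff p.2.toNat E).coeff p.1 else 0

theorem coeffFun_mul_fac (E : PowerSeries (AddMonoidAlgebra ℤ M)) (v : M) :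
    coeffFun (E * (fac v : PowerSeries (AddMonoidAlgebra ℤ M))) =
      act (binom (v, (1 : ℤ))) (coeffFun E) := by
  funext ⟨m, k⟩
  rw [act_binom]
  simp only [coeffFun, Prod.mk_sub_mk]
  rcases lt_trichotomy k 0 with hk | rfl | hk
  · rw [if_neg (by omega), if_neg (by omega), if_neg (by omega), sub_zero]
  -- At height 0 the shifted index is -1, where `coeffFun` is 0 by convention.
  · have := coeff_zero_mul_fac E v
    simp only [le_refl, if_true, Int.toNat_zero, this]
    simp
  · obtain ⟨n, rfl⟩ : ∃ n : ℕ, k = (n + 1 : ℕ) := ⟨(k - 1).toNat, by omega⟩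
    rw [if_pos (by omega), if_pos (by omega), if_pos (by omega), Int.toNat_natCast,
      coeff_succ_mul_fac, show ((n + 1 : ℕ) - 1 : ℤ).toNat = n by omega, AddMonoidAlgebra.coeff_sub,
      Finsupp.sub_apply, AddMonoidAlgebra.coeff_single_mul_apply, one_mul, neg_add_eq_sub]

theorem coeffFun_mul_prod_fac (E : PowerSeries (AddMonoidAlgebra ℤ M)) (V : Finset M) :
    coeffFun (E * ((∏ v ∈ V, fac v : (AddMonoidAlgebra ℤ M)[X]) :
      PowerSeries (AddMonoidAlgebra ℤ M))) =
      act (∏ v ∈ V, binom (v, (1 : ℤ))) (coeffFun E) := by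
  classical
  induction V using Finset.induction_on with
  | empty => simp
  | insert v V hv ih =>
    rw [Finset.prod_insert hv, Finset.prod_insert hv, act_mul_apply, ← ih, ← coeffFun_mul_fac,
      Polynomial.coe_mul]
    congr 1
    ring

/-- A power series with almost all coefficients zero is a polynomial. -/
theorem exists_polynomial_eq {R : Type*} [CommRing R] (E : PowerSeries R) (k : ℕ)
    (h : ∀ n, k ≤ n → coeff n E = 0) : ∃ N : R[X], E = (N : PowerSeries R) := by
  refine ⟨trunc k E, ?_⟩
  ext n
  rw [Polynomial.coeff_coe, coeff_trunc]
  split_ifs with hn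
  · rfl
  · exact h n (not_lt.1 hn)

theorem exists_polynomial_of_coeffFun_eq (E : PowerSeries (AddMonoidAlgebra ℤ M))
    (b : AddMonoidAlgebra ℤ (M × ℤ)) (h : coeffFun E = ⇑b.coeff) :
    ∃ N : (AddMonoidAlgebra ℤ M)[X], E = (N : PowerSeries (AddMonoidAlgebra ℤ M)) := by
  classical
  refine exists_polynomial_eq E ((b.coeff.support.sup fun p => p.2.toNat) + 1) fun n hn => ?_
  ext m
  have h1 : (coeff n E).coeff m = b.coeff (m, (n : ℤ)) := by
    rw [← h]
    simp [coeffFun]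
  rw [h1]
  by_contra hne
  have := Finset.le_sup (f := fun p : M × ℤ => p.2.toNat) (Finsupp.mem_support_iff.2 hne)
  simp only [Int.toNat_natCast] at this
  omega

/-- Pointwise convergence of the coefficients of a series to a function on `M`. -/
def TendsCoeff (H : PowerSeries (AddMonoidAlgebra ℤ M)) (f : M → ℤ) : Prop :=
  ∀ m, ∀ᶠ n in atTop, (coeff n H).coeff m = f m

theorem TendsCoeff.unique {H : PowerSeries (AddMonoidAlgebra ℤ M)} {f g : M → ℤ}
    (hf : TendsCoeff H f) (hg : TendsCoeff H g) : f = g := by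
  funext m
  obtain ⟨n, h1, h2⟩ := ((hf m).and (hg m)).exists
  exact h1.symm.trans h2

/-- Coefficients n and n + 1 have the same limit, so multiplying by 1 - x^v t acts on the limit as
its value 1 - x^v at t = 1. -/
theorem TendsCoeff.mul_fac {H : PowerSeries (AddMonoidAlgebra ℤ M)} {f : M → ℤ}
    (hf : TendsCoeff H f) (v : M) :
    TendsCoeff (H * (fac v : PowerSeries (AddMonoidAlgebra ℤ M))) (act (binom v) f) := by
  intro m
  rw [act_binom, ← Filter.map_add_atTop_eq_nat 1, Filter.eventually_map]
  filter_upwards [(Filter.tendsto_add_atTop_nat 1).eventually (hf m), hf (m - v)] with n h1 h2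
  rw [coeff_succ_mul_fac, AddMonoidAlgebra.coeff_sub,
      Finsupp.sub_apply, AddMonoidAlgebra.coeff_single_mul_apply, one_mul, neg_add_eq_sub, h1, h2]

theorem TendsCoeff.mul_prod_fac {ι : Type*} {H : PowerSeries (AddMonoidAlgebra ℤ M)} {f : M → ℤ}
    (hf : TendsCoeff H f) (V : Finset ι) (u : ι → M) :
    TendsCoeff (H * ((∏ v ∈ V, fac (u v) : (AddMonoidAlgebra ℤ M)[X]) :
      PowerSeries (AddMonoidAlgebra ℤ M))) (act (∏ v ∈ V, binom (u v)) f) := by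
  classical
  induction V using Finset.induction_on with
  | empty => simpa using hf
  | insert v V hv ih =>
    have := ih.mul_fac (u v)
    rw [Finset.prod_insert hv, Finset.prod_insert hv]
    rwa [← act_mul_apply, mul_assoc, ← Polynomial.coe_mul, mul_comm (∏ v ∈ V, fac (u v))] at this

theorem fac_zero : fac (0 : M) = 1 - Polynomial.X := by
  simp [fac, ← AddMonoidAlgebra.one_def]

/-- If H (1 - t) = N, the coefficients of H are the partial sums of those of N, hence eventually
equal to N(1). -/
theorem tendsCoeff_of_mul_fac_zero (H : PowerSeries (AddMonoidAlgebra ℤ M))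
    (N : (AddMonoidAlgebra ℤ M)[X])
    (h : H * (fac (0 : M) : PowerSeries (AddMonoidAlgebra ℤ M)) = N) :
    TendsCoeff H ⇑(N.eval 1).coeff := by
  have key : ∀ n, coeff n H = ∑ i ∈ Finset.range (n + 1), N.coeff i := by
    intro n
    induction n with
    | zero =>
      rw [Finset.sum_range_one, ← coeff_zero_mul_fac H 0, h, Polynomial.coeff_coe]
    | succ n ih =>
      rw [Finset.sum_range_succ, ← ih, ← Polynomial.coeff_coe, ← h, coeff_succ_mul_fac,
        ← AddMonoidAlgebra.one_def]
      ring
  intro m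
  filter_upwards [eventually_ge_atTop N.natDegree] with n hn
  rw [key, Polynomial.eval_eq_sum_range' (Nat.lt_succ_of_le hn)]
  simp

theorem rescale_coe {R : Type*} [CommRing R] (a : R) (N : R[X]) :
    rescale a (N : PowerSeries R) = (N.comp (Polynomial.C a * Polynomial.X) : R[X]) := by
  ext n
  rw [coeff_rescale, Polynomial.coeff_coe, Polynomial.coeff_coe, Polynomial.comp_C_mul_X_coeff,
    mul_comm]

/-- Substituting x^(-v) t for t moves the pole of `fac v` to t = 1. -/
theorem fac_comp (v w : M) :
    (fac w).comp (Polynomial.C (AddMonoidAlgebra.single (-v) 1) * Polynomial.X) = fac (w - v) := by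
  simp only [fac, Polynomial.sub_comp, Polynomial.one_comp, Polynomial.mul_comp, Polynomial.C_comp,
    Polynomial.X_comp, ← mul_assoc, ← Polynomial.C_mul, AddMonoidAlgebra.single_mul_single, one_mul]
  rw [sub_eq_add_neg w v]

/-- If the series `E` has denominator `∏ (1 - x ^ w t)` and its coefficients, shifted by `-n v`,
converge to `K`, then `K` is the residue of `E` at the pole `t = x ^ (-v)`. -/
theorem act_prod_eq_eval [DecidableEq M] {E : PowerSeries (AddMonoidAlgebra ℤ M)} {V : Finset M}
    {N : (AddMonoidAlgebra ℤ M)[X]}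
    (hN : E * ((∏ w ∈ V, fac w : (AddMonoidAlgebra ℤ M)[X]) :
      PowerSeries (AddMonoidAlgebra ℤ M)) = N) {v : M} (hv : v ∈ V) {K : M → ℤ}
    (hK : ∀ m, ∀ᶠ n in atTop, (coeff n E).coeff (m + n • v) = K m) :
    act (∏ w ∈ V.erase v, binom (w - v)) K =
      ⇑(N.eval (AddMonoidAlgebra.single (-v) 1)).coeff := by
  set a : AddMonoidAlgebra ℤ M := AddMonoidAlgebra.single (-v) 1 with ha
  have h1 : TendsCoeff (rescale a E) K := by
    intro m
    filter_upwards [hK m] with n hn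
    rw [coeff_rescale, ha, AddMonoidAlgebra.single_pow, one_pow,
      AddMonoidAlgebra.coeff_single_mul_apply, one_mul, ← hn]
    congr 1
    rw [smul_neg, neg_neg, add_comm]
  -- The rescaled series times the factors with w ≠ v has two descriptions of its limit: by K, and
  -- by N at the pole, since the one factor left out has become 1 - t.
  refine (h1.mul_prod_fac (V.erase v) fun w => w - v).unique ?_
  have h2 := tendsCoeff_of_mul_fac_zero (rescale a E *
    ((∏ w ∈ V.erase v, fac (w - v) : (AddMonoidAlgebra ℤ M)[X]) :
      PowerSeries (AddMonoidAlgebra ℤ M))) (N.comp (Polynomial.C a * Polynomial.X)) (by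
    rw [← rescale_coe, ← hN, map_mul, rescale_coe, Polynomial.prod_comp, mul_assoc,
      ← Polynomial.coe_mul, ← sub_self v, Finset.prod_erase_mul V (fun w => fac (w - v)) hv]
    simp only [ha, fac_comp])
  simpa [Polynomial.eval_comp] using h2

theorem prod_X_sub_C_dvd {R ι : Type*} [CommRing R] [IsDomain R] (p : R[X]) (s : Finset ι)
    (a : ι → R) (ha : Set.InjOn a s) (h : ∀ i ∈ s, p.eval (a i) = 0) :
    (∏ i ∈ s, (Polynomial.X - Polynomial.C (a i))) ∣ p := by
  classical
  by_cases hp : p = 0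
  · simp [hp]
  have := (Multiset.prod_X_sub_C_dvd_iff_le_roots hp (s.image a).val).2
    ((Multiset.le_iff_subset (s.image a).nodup).2 fun x hx => by
      obtain ⟨i, hi, rfl⟩ := Finset.mem_image.1 hx
      exact (Polynomial.mem_roots hp).2 (h i hi))
  change (∏ x ∈ s.image a, (Polynomial.X - Polynomial.C x)) ∣ p at this
  rwa [Finset.prod_image ha] at this

/-- The roots x^(-v) are distinct in a domain, and 1 - x^v t is t - x^(-v) up to the unit -x^v. -/
theorem prod_fac_dvd [Module.Free ℤ M] (p : (AddMonoidAlgebra ℤ M)[X]) (V : Finset M)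
    (h : ∀ v ∈ V, p.eval (AddMonoidAlgebra.single (-v) 1) = 0) : (∏ v ∈ V, fac v) ∣ p := by
  have := isDomain_groupRing M
  refine dvd_trans ?_ (prod_X_sub_C_dvd p V (fun v => AddMonoidAlgebra.single (-v) 1) ?_ h)
  · refine Finset.prod_dvd_prod_of_dvd _ _ fun v _ =>
      ⟨Polynomial.C (-AddMonoidAlgebra.single (-v) 1), ?_⟩
    have : (Polynomial.C (AddMonoidAlgebra.single v 1) *
        Polynomial.C (AddMonoidAlgebra.single (-v) 1) : (AddMonoidAlgebra ℤ M)[X]) = 1 := by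
      rw [← Polynomial.C_mul, AddMonoidAlgebra.single_mul_single, add_neg_cancel, mul_one,
        ← AddMonoidAlgebra.one_def, Polynomial.C_1]
    rw [fac, Polynomial.C_neg]
    linear_combination -Polynomial.X * this
  · intro v _ w _ hvw
    exact neg_injective (AddMonoidAlgebra.single_left_injective one_ne_zero hvw)

theorem fac_eval_self (v w : M) :
    (fac w).eval (AddMonoidAlgebra.single (-v) 1) = binom (w - v) := by
  simp [fac, binom, AddMonoidAlgebra.single_mul_single, sub_eq_add_neg]

theorem binom_zero : binom (0 : M) = 0 := by
  simp [binom, ← AddMonoidAlgebra.one_def]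

/-- Partial fraction decomposition of the multigraded series, with a common denominator `∏ p v`
for the residues `g v / p v`. -/
theorem exists_partial_fractions [DecidableEq M] [Module.Free ℤ M]
    {E : PowerSeries (AddMonoidAlgebra ℤ M)}
    {V : Finset M} {N : (AddMonoidAlgebra ℤ M)[X]}
    (hN : E * ((∏ w ∈ V, fac w : (AddMonoidAlgebra ℤ M)[X]) :
      PowerSeries (AddMonoidAlgebra ℤ M)) = N) (K : M → M → ℤ)
    (hK : ∀ v ∈ V, ∀ m, ∀ᶠ n in atTop, (coeff n E).coeff (m + n • v) = K v m)
    (p g : M → AddMonoidAlgebra ℤ M) (hg : ∀ v ∈ V, act (p v) (K v) = ⇑(g v).coeff) :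
    ∃ (U : (AddMonoidAlgebra ℤ M)[X]) (c : M → AddMonoidAlgebra ℤ M),
      Polynomial.C (∏ v ∈ V, p v) * N =
        U * ∏ w ∈ V, fac w + ∑ v ∈ V, Polynomial.C (c v) * ∏ w ∈ V.erase v, fac w := by
  -- Functions on M allow no division, so p v and the binomials are applied to K v in both orders
  -- and the results compared in ℤ[M].
  have hres : ∀ v ∈ V, (g v) * ∏ w ∈ V.erase v, binom (w - v) =
      p v * N.eval (AddMonoidAlgebra.single (-v) 1) := by
    intro v hv
    apply AddMonoidAlgebra.coeff_injective
    apply DFunLike.coe_injective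
    rw [mul_comm (g v), ← act_coeff _ (g v), ← act_coeff (p v), ← act_prod_eq_eval hN hv (hK v hv),
      ← hg v hv, ← act_mul_apply, ← act_mul_apply, mul_comm]
  -- c v is the residue with all the p w cleared; the difference below then vanishes at every pole.
  let c : M → AddMonoidAlgebra ℤ M := fun v => (∏ w ∈ V.erase v, p w) * g v
  obtain ⟨U, hU⟩ := prod_fac_dvd (Polynomial.C (∏ v ∈ V, p v) * N -
      ∑ v ∈ V, Polynomial.C (c v) * ∏ w ∈ V.erase v, fac w) V (by
    intro v hv
    rw [Polynomial.eval_sub, Polynomial.eval_mul, Polynomial.eval_C, Polynomial.eval_finsetSum,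
      Finset.sum_eq_single_of_mem v hv]
    · simp only [Polynomial.eval_mul, Polynomial.eval_C, Polynomial.eval_prod, fac_eval_self, c,
        mul_assoc, hres v hv]
      rw [← mul_assoc, Finset.prod_erase_mul V p hv, sub_self]
    · intro w hw hwv
      rw [Polynomial.eval_mul, Polynomial.eval_prod,
        Finset.prod_eq_zero (Finset.mem_erase.2 ⟨hwv.symm, hv⟩), mul_zero]
      rw [fac_eval_self, sub_self, binom_zero])
  exact ⟨U, c, by rw [mul_comm U, ← hU]; ring⟩

end Series

/-! ### Extreme rays, edges of polytopes and Gordan's lemma. -/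

section Cones

open scoped NNReal

variable {E : Type*} [AddCommGroup E] [Module ℝ E]

theorem real_smul_mem (C : Submodule ℝ≥0 E) {a : ℝ} (ha : 0 ≤ a) {x : E} (hx : x ∈ C) :
    a • x ∈ C := by
  have := C.smul_mem a.toNNReal hx
  rwa [NNReal.smul_def, Real.coe_toNNReal _ ha] at this

/-- A pointed finitely generated cone is generated by finitely many of its generators, each of
which spans an extreme ray. -/
theorem exists_extreme_rays (T : Finset E)
    (hp : ∀ x ∈ Submodule.span ℝ≥0 (T : Set E), -x ∈ Submodule.span ℝ≥0 (T : Set E) → x = 0) :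
    ∃ G ⊆ T, Submodule.span ℝ≥0 (G : Set E) = Submodule.span ℝ≥0 (T : Set E) ∧
      ∀ g ∈ G, g ≠ 0 ∧ ∀ x ∈ Submodule.span ℝ≥0 (T : Set E),
        ∀ y ∈ Submodule.span ℝ≥0 (T : Set E),
          x + y ∈ Submodule.span ℝ≥0 {g} → x ∈ Submodule.span ℝ≥0 {g} := by
  classical
  -- A generating subset of least cardinality has no redundant generator.
  obtain ⟨G, hG, hmin⟩ := Finset.exists_min_image
    (T.powerset.filter fun G : Finset E => Submodule.span ℝ≥0 (G : Set E) = Submodule.span ℝ≥0 (T : Set E))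
    Finset.card ⟨T, by simp⟩
  simp only [Finset.mem_filter, Finset.mem_powerset] at hG hmin
  have hnot : ∀ g ∈ G, g ∉ Submodule.span ℝ≥0 ((G.erase g : Finset E) : Set E) := by
    intro g hg hmem
    refine absurd (hmin (G.erase g) ⟨(Finset.erase_subset _ _).trans hG.1, ?_⟩)
      (not_le.2 (Finset.card_erase_lt_of_mem hg))
    rw [← hG.2]
    nth_rewrite 2 [← Finset.insert_erase hg]
    rw [Finset.coe_insert, Submodule.span_insert_eq_span hmem]
  refine ⟨G, hG.1, hG.2, fun g hg => ?_⟩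
  have hg0 : g ≠ 0 := fun h => hnot g hg (h ▸ Submodule.zero_mem _)
  refine ⟨hg0, ?_⟩
  rw [← hG.2] at hp ⊢
  have hle : Submodule.span ℝ≥0 ((G.erase g : Finset E) : Set E) ≤
      Submodule.span ℝ≥0 (G : Set E) := Submodule.span_mono (by simp)
  intro x hx y hy hxy
  have hins : (G : Set E) = insert g ((G.erase g : Finset E) : Set E) := by
    rw [← Finset.coe_insert, Finset.insert_erase hg]
  have hgG : g ∈ Submodule.span ℝ≥0 (G : Set E) := Submodule.subset_span hg
  have hx' := hx
  have hy' := hy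
  rw [hins, Submodule.mem_span_insert] at hx' hy'
  obtain ⟨a, x', hx', rfl⟩ := hx'
  obtain ⟨b, y', hy', rfl⟩ := hy'
  obtain ⟨r, hr⟩ := Submodule.mem_span_singleton.1 hxy
  have hr' : x' + y' = ((r : ℝ) - a - b) • g := by
    simp only [NNReal.smul_def] at hr
    rw [sub_smul, sub_smul, hr]
    abel
  -- The components off g satisfy x' + y' = (r - a - b) g. A negative coefficient contradicts
  -- pointedness, a positive one makes g redundant, and zero forces x' = 0.
  rcases lt_trichotomy ((r : ℝ) - a - b) 0 with h | h | h
  · exfalso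
    have h1 := hp ((-((r : ℝ) - a - b)) • g) (real_smul_mem _ (by linarith) hgG) (by
      rw [neg_smul, neg_neg, ← hr']
      exact hle (add_mem hx' hy'))
    rw [smul_eq_zero] at h1
    rcases h1 with h1 | h1
    · linarith
    · exact hg0 h1
  · rw [h, zero_smul] at hr'
    have : x' = 0 := hp x' (hle hx') (by
      rw [neg_eq_of_add_eq_zero_right hr']
      exact hle hy')
    rw [this, add_zero]
    exact Submodule.smul_mem _ _ (Submodule.mem_span_singleton_self g)
  · exfalso
    refine hnot g hg ?_
    have h1 := real_smul_mem _ (inv_nonneg.2 h.le) (add_mem hx' hy')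
    rwa [hr', smul_smul,
      inv_mul_cancel₀ h.ne', one_smul] at h1

theorem smul_add_mem_of_le {Q : Set E} (hQ : Convex ℝ Q) {v x : E} (hv : v ∈ Q) {ε δ : ℝ}
    (hx : v + ε • x ∈ Q) (hδ : 0 ≤ δ) (hε : 0 < ε) (h : δ ≤ ε) : v + δ • x ∈ Q := by
  have := hQ.add_smul_mem hv hx (t := δ / ε) ⟨by positivity, by rwa [div_le_one hε]⟩
  rwa [smul_smul, div_mul_cancel₀ _ hε.ne'] at this

/-- The directions of the tangent cone at `v` are feasible. -/
theorem exists_add_smul_mem {V : Set E} {v : E} (hv : v ∈ convexHull ℝ V) {x : E}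
    (hx : x ∈ Submodule.span ℝ≥0 ((fun w => w - v) '' V)) :
    ∃ ε : ℝ, 0 < ε ∧ v + ε • x ∈ convexHull ℝ V := by
  have hQ := convex_convexHull ℝ V
  induction hx using Submodule.span_induction with
  | mem x hx =>
    obtain ⟨w, hw, rfl⟩ := hx
    exact ⟨1, one_pos, by simpa using subset_convexHull ℝ V hw⟩
  | zero => exact ⟨1, one_pos, by simpa using hv⟩
  | add x y _ _ hx hy =>
    obtain ⟨ε, hε, hx⟩ := hx
    obtain ⟨δ, hδ, hy⟩ := hy
    have h1 := smul_add_mem_of_le hQ hv hx (le_min hε.le hδ.le) hε (min_le_left ε δ)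
    have h2 := smul_add_mem_of_le hQ hv hy (le_min hε.le hδ.le) hδ (min_le_right ε δ)
    refine ⟨min ε δ / 2, by positivity, ?_⟩
    convert hQ h1 h2 (a := 1 / 2) (b := 1 / 2) (by norm_num) (by norm_num) (by norm_num) using 1
    module
  | smul c x _ hx =>
    obtain ⟨ε, hε, hx⟩ := hx
    have hc : (0 : ℝ) ≤ c := c.2
    refine ⟨ε / (c + 1), by positivity, ?_⟩
    rw [NNReal.smul_def, smul_smul]
    refine smul_add_mem_of_le hQ hv hx (by positivity) hε ?_
    rw [div_mul_eq_mul_div, div_le_iff₀ (by positivity)]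
    nlinarith

theorem sub_mem_span_of_mem_convexHull {V : Set E} (v : E) {x : E} (hx : x ∈ convexHull ℝ V) :
    x - v ∈ Submodule.span ℝ≥0 ((fun w => w - v) '' V) := by
  refine convexHull_min (t := {x | x - v ∈ Submodule.span ℝ≥0 ((fun w => w - v) '' V)})
    (fun w hw => Submodule.subset_span ⟨w, hw, rfl⟩) ?_ hx
  intro x hx y hy a b ha hb hab
  rw [Set.mem_ofPred_eq] at hx hy ⊢
  have := add_mem (real_smul_mem _ ha hx) (real_smul_mem _ hb hy)
  convert this using 1
  rw [smul_sub, smul_sub, sub_add_sub_comm, ← add_smul, hab, one_smul]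

/-- The tangent cone of a polytope at a vertex is generated by the edges. -/
theorem exists_edge_generators (V : Finset E) {v : E}
    (hv : v ∈ (convexHull ℝ (V : Set E)).extremePoints ℝ) :
    ∃ G ⊆ V, Submodule.span ℝ≥0 ((fun w => w - v) '' (G : Set E)) =
        Submodule.span ℝ≥0 ((fun w => w - v) '' (V : Set E)) ∧
      ∀ g ∈ G, ∃ y, v ≠ y ∧ IsExtreme ℝ (convexHull ℝ (V : Set E)) (segment ℝ v y) ∧
        ∃ s : ℝ, y - v = s • (g - v) := by
  classical
  set Q := convexHull ℝ (V : Set E) with hQdef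
  have hQ : Convex ℝ Q := convex_convexHull ℝ _
  set T : Finset E := V.image fun w => w - v with hT
  have hTV : (T : Set E) = (fun w => w - v) '' (V : Set E) := by rw [hT, Finset.coe_image]
  -- The tangent cone is pointed because v is extreme: v would lie strictly between v + εx and v -
  -- δx.
  have hp : ∀ x ∈ Submodule.span ℝ≥0 (T : Set E),
      -x ∈ Submodule.span ℝ≥0 (T : Set E) → x = 0 := by
    intro x hx hx'
    rw [hTV] at hx hx'
    obtain ⟨ε, hε, h1⟩ := exists_add_smul_mem hv.1 hx
    obtain ⟨δ, hδ, h2⟩ := exists_add_smul_mem hv.1 hx'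
    have := hv.2 h1 h2 ⟨δ / (ε + δ), ε / (ε + δ), by positivity, by positivity, by field_simp; ring,
      by
        have h3 : δ / (ε + δ) + ε / (ε + δ) = 1 := by field_simp; ring
        have h4 : δ / (ε + δ) * ε = ε / (ε + δ) * δ := by ring
        rw [smul_add, smul_add, smul_smul, smul_smul, smul_neg, h4, add_add_add_comm, ← add_smul,
          h3, one_smul, add_neg_cancel, add_zero]⟩
    rw [add_eq_left, smul_eq_zero] at this
    exact this.resolve_left hε.ne'
  obtain ⟨G', hG'T, hspan, hray⟩ := exists_extreme_rays T hp
  obtain ⟨G, hGV, rfl⟩ := Finset.subset_image_iff.1 hG'T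
  rw [Finset.coe_image, hTV] at hspan
  rw [hTV] at hray
  refine ⟨G, hGV, hspan, fun u hu => ?_⟩
  obtain ⟨hg0, hext⟩ := hray (u - v) (Finset.mem_image_of_mem _ hu)
  set g := u - v with hg
  have hcone : ∀ x ∈ Q, x - v ∈ Submodule.span ℝ≥0 ((fun w => w - v) '' (V : Set E)) :=
    fun x hx => sub_mem_span_of_mem_convexHull v hx
  have hface : ∀ x ∈ Q, ∀ y ∈ Q, ∀ a b : ℝ, 0 < a → 0 ≤ b → a + b = 1 →
      (a • x + b • y) - v ∈ Submodule.span ℝ≥0 {g} → x - v ∈ Submodule.span ℝ≥0 {g} := by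
    intro x hx y hy a b ha hb hab h
    have h1 := hext _ (real_smul_mem _ ha.le (hcone x hx)) _
      (real_smul_mem _ hb (hcone y hy)) (by
        rwa [smul_sub, smul_sub, sub_add_sub_comm, ← add_smul, hab, one_smul])
    have h2 := real_smul_mem _ (inv_nonneg.2 ha.le) h1
    rwa [smul_smul, inv_mul_cancel₀ ha.ne', one_smul] at h2
  have hex : ∀ w ∈ V, ∃ r : ℝ, w - v ∈ Submodule.span ℝ≥0 {g} → 0 ≤ r ∧ w - v = r • g := by
    intro w _
    by_cases hw : w - v ∈ Submodule.span ℝ≥0 {g}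
    · obtain ⟨r, hr⟩ := Submodule.mem_span_singleton.1 hw
      exact ⟨r, fun _ => ⟨r.2, hr.symm⟩⟩
    · exact ⟨0, fun h => absurd h hw⟩
  choose! r hr using hex
  -- The far end of the edge is the point of V on the ray through g farthest from v.
  obtain ⟨y, hy, hmax⟩ := Finset.exists_max_image
    (V.filter fun w => w - v ∈ Submodule.span ℝ≥0 {g}) r
    ⟨u, Finset.mem_filter.2 ⟨hGV hu, Submodule.mem_span_singleton_self _⟩⟩
  rw [Finset.mem_filter] at hy
  have hyr := hr y hy.1 hy.2
  have hru : r u = 1 := by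
    have h1 := (hr u (hGV hu) (Submodule.mem_span_singleton_self _)).2
    rw [← hg] at h1
    have h2 : (r u - 1) • g = 0 := by rw [sub_smul, one_smul, ← h1, sub_self]
    linarith [(smul_eq_zero.1 h2).resolve_right hg0]
  have hpos : 0 < r y := by
    have := hmax u (Finset.mem_filter.2 ⟨hGV hu, Submodule.mem_span_singleton_self _⟩)
    linarith
  -- The bound passes from V to its hull: by `hface`, a convex combination lies on the ray only if
  -- both of its points do.
  have hbound : ∀ x ∈ Q, x - v ∈ Submodule.span ℝ≥0 {g} →
      ∃ t : ℝ, 0 ≤ t ∧ t ≤ r y ∧ x - v = t • g := by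
    intro x hx
    refine (convexHull_min (t := {x | x ∈ Q ∧ (x - v ∈ Submodule.span ℝ≥0 {g} →
      ∃ t : ℝ, 0 ≤ t ∧ t ≤ r y ∧ x - v = t • g)}) ?_ ?_ hx).2
    · intro w hw
      refine ⟨subset_convexHull _ _ hw, fun h => ⟨r w, (hr w hw h).1, ?_, (hr w hw h).2⟩⟩
      exact hmax w (Finset.mem_filter.2 ⟨hw, h⟩)
    · rw [convex_iff_forall_pos]
      rintro x ⟨hx, hx'⟩ y ⟨hy, hy'⟩ a b ha hb hab
      refine ⟨hQ hx hy ha.le hb.le hab, fun h => ?_⟩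
      obtain ⟨t, ht0, ht, h1⟩ := hx' (hface x hx y hy a b ha hb.le hab h)
      obtain ⟨s, hs0, hs, h2⟩ := hy' (hface y hy x hx b a hb ha.le (by linarith)
        (by rwa [add_comm (b • y)]))
      refine ⟨a * t + b * s, by positivity, ?_, ?_⟩
      · calc a * t + b * s ≤ a * r _ + b * r _ := by gcongr
          _ = r _ := by rw [← add_mul, hab, one_mul]
      · rw [add_smul, mul_smul, mul_smul, ← h1, ← h2, smul_sub, smul_sub, sub_add_sub_comm,
          ← add_smul, hab, one_smul]
  have hseg : ∀ x, x ∈ segment ℝ v y ↔ x ∈ Q ∧ x - v ∈ Submodule.span ℝ≥0 {g} := by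
    intro x
    rw [segment_eq_image', Set.mem_image]
    constructor
    · rintro ⟨θ, hθ, rfl⟩
      refine ⟨hQ.add_smul_sub_mem hv.1 (subset_convexHull _ _ hy.1) hθ, ?_⟩
      rw [add_sub_cancel_left]
      exact real_smul_mem _ hθ.1 hy.2
    · rintro ⟨hx, h⟩
      obtain ⟨t, ht0, ht, h1⟩ := hbound x hx h
      refine ⟨t / r y, ⟨by positivity, by rwa [div_le_one hpos]⟩, ?_⟩
      rw [hyr.2, smul_smul, div_mul_cancel₀ _ hpos.ne', ← h1, add_sub_cancel]
  refine ⟨y, ?_, ⟨fun x hx => ((hseg x).1 hx).1, ?_⟩, r y, hyr.2⟩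
  · rintro rfl
    have := hyr.2
    rw [sub_self] at this
    exact smul_ne_zero hpos.ne' hg0 this.symm
  · rintro x hx z hz _ hs ⟨a, b, ha, hb, hab, rfl⟩
    exact (hseg x).2 ⟨hx, hface x hx z hz a b ha hb.le hab ((hseg _).1 hs).2⟩

/-- Gordan's lemma: the lattice points of a rational cone form a finitely generated set over the
monoid spanned by the given generators. -/
theorem exists_eq_add_closure_of_cone {L κ : Type*} [AddCommGroup L] [Finite κ] (i : L →+ E)
    (φ : κ → E →ₗ[ℝ] ℝ) (ψ : κ → L → ℤ) (hφ : ∀ k x, φ k (i x) = ψ k x)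
    (hψ : Function.Injective fun x k => ψ k x) (G : Finset L) :
    ∃ F : Finset L, {x | i x ∈ Submodule.span ℝ≥0 (i '' (G : Set L))} =
      (F : Set L) + AddSubmonoid.closure (G : Set L) := by
  classical
  -- P is the set of lattice points of the zonotope of G, finite because its integer coordinates ψ
  -- are bounded. Integer parts of the coefficients go to the monoid, fractional parts to P.
  let P : Set L := {x | ∃ d : L → ℝ, (∀ g, 0 ≤ d g ∧ d g ≤ 1) ∧ i x = ∑ g ∈ G, d g • i g}
  have hP : P.Finite := by
    have hfin : (Set.pi Set.univ fun k => Set.Icc (-∑ g ∈ G, |ψ k g|) (∑ g ∈ G, |ψ k g|)).Finite :=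
      Set.Finite.pi fun i => Set.finite_Icc _ _
    refine Set.Finite.of_finite_image (f := fun x k => ψ k x) (hfin.subset ?_) hψ.injOn
    rintro _ ⟨x, ⟨d, hd, hx⟩, rfl⟩ k -
    refine abs_le.1 ?_
    have h1 : |(ψ k x : ℝ)| ≤ ∑ g ∈ G, |(ψ k g : ℝ)| := by
      rw [← hφ, hx, map_sum]
      refine (Finset.abs_sum_le_sum_abs _ _).trans (Finset.sum_le_sum fun g _ => ?_)
      rw [map_smul, hφ, smul_eq_mul, abs_mul, abs_of_nonneg (hd g).1]
      exact mul_le_of_le_one_left (abs_nonneg _) (hd g).2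
    exact_mod_cast h1
  refine ⟨hP.toFinset, ?_⟩
  rw [Set.Finite.coe_toFinset]
  have hG : ∀ g ∈ G, i g ∈ Submodule.span ℝ≥0 (i '' (G : Set L)) :=
    fun g hg => Submodule.subset_span ⟨g, hg, rfl⟩
  ext x
  rw [Set.mem_ofPred_eq, Set.mem_add]
  constructor
  · intro hx
    obtain ⟨c₀, hc₀⟩ := (Submodule.mem_span_image_finset_iff_exists_fun ℝ≥0).1 hx
    obtain ⟨c, hc⟩ : ∃ c : L → ℝ≥0, ∑ g ∈ G, c g • i g = i x :=
      ⟨fun g => if h : g ∈ G then c₀ ⟨g, h⟩ else 0, by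
        rw [← hc₀, ← Finset.sum_coe_sort]
        simp⟩
    refine ⟨x - ∑ g ∈ G, ⌊c g⌋₊ • g, ⟨fun g => (c g : ℝ) - ⌊c g⌋₊, fun g => ⟨?_, ?_⟩, ?_⟩,
      ∑ g ∈ G, ⌊c g⌋₊ • g, ?_, sub_add_cancel _ _⟩
    · have := Nat.floor_le (zero_le (a := c g))
      rw [sub_nonneg]
      exact_mod_cast this
    · have := (Nat.lt_floor_add_one (c g)).le
      rw [sub_le_iff_le_add']
      exact_mod_cast this
    · rw [map_sub, ← hc, map_sum, ← Finset.sum_sub_distrib]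
      refine Finset.sum_congr rfl fun g _ => ?_
      rw [sub_smul, NNReal.smul_def, map_nsmul, Nat.cast_smul_eq_nsmul]
    · exact sum_mem fun g hg => AddSubmonoid.nsmul_mem _ (AddSubmonoid.subset_closure hg) _
  · rintro ⟨y, ⟨d, hd, hy⟩, s, hs, rfl⟩
    rw [map_add]
    refine add_mem ?_ ?_
    · rw [hy]
      refine sum_mem fun g hg => ?_
      exact real_smul_mem _ (hd g).1 (hG g hg)
    · have : AddSubmonoid.closure (G : Set L) ≤
          (Submodule.span ℝ≥0 (i '' (G : Set L))).toAddSubmonoid.comap i :=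
        AddSubmonoid.closure_le.2 hG
      exact this hs

end Cones

/-! ### The multigraded Ehrhart series and the tangent cones at the vertices. -/

section Assembly

open scoped NNReal
open Filter

/-- The slice of the cone over W × {1} at height r is r times the hull. Nonemptiness matters at r =
0, where the slice is {0}. -/
theorem mem_span_cone_iff {E : Type*} [AddCommGroup E] [Module ℝ E] {W : Set E} (hW : W.Nonempty)
    (x : E) (r : ℝ) :
    (x, r) ∈ Submodule.span ℝ≥0 ((fun w => (w, (1 : ℝ))) '' W) ↔
      0 ≤ r ∧ x ∈ r • convexHull ℝ W := by
  have hQ := convex_convexHull ℝ W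
  constructor
  · intro h
    suffices ∀ p ∈ Submodule.span ℝ≥0 ((fun w => (w, (1 : ℝ))) '' W),
        0 ≤ p.2 ∧ p.1 ∈ p.2 • convexHull ℝ W from this _ h
    intro p hp
    induction hp using Submodule.span_induction with
    | mem p hp =>
      obtain ⟨w, hw, rfl⟩ := hp
      exact ⟨zero_le_one, by simpa using subset_convexHull ℝ W hw⟩
    | zero =>
      refine ⟨le_rfl, ?_⟩
      rw [Prod.snd_zero, Prod.fst_zero, Set.zero_smul_set hW.convexHull]
      exact rfl
    | add p q _ _ hp hq =>
      refine ⟨add_nonneg hp.1 hq.1, ?_⟩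
      rw [Prod.snd_add, hQ.add_smul hp.1 hq.1]
      exact Set.add_mem_add hp.2 hq.2
    | smul c p _ hp =>
      refine ⟨mul_nonneg c.2 hp.1, ?_⟩
      have : (c • p).2 • convexHull ℝ W = (c : ℝ) • p.2 • convexHull ℝ W := by
        rw [smul_smul]
        rfl
      rw [this]
      exact Set.smul_mem_smul_set hp.2
  · rintro ⟨hr, y, hy, rfl⟩
    have h1 : (y, (1 : ℝ)) ∈ Submodule.span ℝ≥0 ((fun w => (w, (1 : ℝ))) '' W) := by
      refine convexHull_min
        (t := {y | (y, (1 : ℝ)) ∈ Submodule.span ℝ≥0 ((fun w => (w, (1 : ℝ))) '' W)})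
        (fun w hw => Submodule.subset_span ⟨w, hw, rfl⟩) ?_ hy
      intro x hx y hy a b ha hb hab
      rw [Set.mem_ofPred_eq] at hx hy ⊢
      have := add_mem (real_smul_mem _ ha hx) (real_smul_mem _ hb hy)
      simpa [hab] using this
    simpa using real_smul_mem _ hr h1

variable {M : Type*} [AddCommGroup M]

/-- A lattice polytope is the convex hull of its vertices, which are lattice points. -/
theorem exists_vertices {Q : Set (ℝ ⊗[ℤ] M)} (hQ : IsLatticePolytope Q) :
    ∃ V : Finset M, V.Nonempty ∧ Q = convexHull ℝ (latticeIncl M '' (V : Set M)) ∧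
      ∀ v ∈ V, latticeIncl M v ∈ Q.extremePoints ℝ := by
  classical
  obtain ⟨V₀, hne, hQV⟩ := hQ
  have key := convexHull_subset_convexHull_extremePoints (V₀.image (latticeIncl M))
  rw [Finset.coe_image, ← hQV] at key
  have hsub : Q.extremePoints ℝ ⊆ latticeIncl M '' (V₀ : Set M) := by
    nth_rewrite 1 [hQV]
    exact extremePoints_convexHull_subset
  have himg : latticeIncl M '' ((V₀.filter fun v => latticeIncl M v ∈ Q.extremePoints ℝ :
      Finset M) : Set M) = Q.extremePoints ℝ := by
    ext x
    constructor
    · rintro ⟨v, hv, rfl⟩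
      exact (Finset.mem_filter.1 hv).2
    · intro hx
      obtain ⟨v, hv, rfl⟩ := hsub hx
      exact ⟨v, Finset.mem_filter.2 ⟨hv, hx⟩, rfl⟩
  have hQne : Q.Nonempty := by
    rw [hQV]
    exact (hne.to_set.image _).convexHull
  refine ⟨V₀.filter fun v => latticeIncl M v ∈ Q.extremePoints ℝ, ?_, ?_, ?_⟩
  · have h1 := (hQne.mono key)
    rw [convexHull_nonempty_iff, ← himg, Set.image_nonempty] at h1
    exact_mod_cast h1
  · rw [himg]
    exact key.antisymm (convexHull_min extremePoints_subset (hQV ▸ convex_convexHull ℝ _))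
  · exact fun v hv => (Finset.mem_filter.1 hv).2

/-- The translated dilates `nQ - nv` exhaust the tangent cone at `v`. -/
theorem eventually_mem_dilate_iff (V : Finset M) {v : M} (hv : v ∈ V) (m : M) :
    ∀ᶠ n : ℕ in atTop, m + n • v ∈ latticePoints
      ((n : ℝ) • convexHull ℝ (latticeIncl M '' (V : Set M))) ↔
      latticeIncl M m ∈ Submodule.span ℝ≥0
        ((fun w => w - latticeIncl M v) '' (latticeIncl M '' (V : Set M))) := by
  have hvQ : latticeIncl M v ∈ convexHull ℝ (latticeIncl M '' (V : Set M)) :=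
    subset_convexHull _ _ ⟨v, hv, rfl⟩
  have hexp : ∀ n : ℕ, latticeIncl M (m + n • v) = latticeIncl M m + (n : ℝ) • latticeIncl M v := by
    intro n
    rw [map_add, map_nsmul, Nat.cast_smul_eq_nsmul]
  by_cases hm : latticeIncl M m ∈ Submodule.span ℝ≥0
        ((fun w => w - latticeIncl M v) '' (latticeIncl M '' (V : Set M)))
  -- If v + ε m lies in the polytope, so does v + m / n once n ≥ 1 / ε.
  · obtain ⟨ε, hε, h⟩ := exists_add_smul_mem hvQ hm
    filter_upwards [eventually_ge_atTop (⌈ε⁻¹⌉₊ + 1)] with n hn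
    refine iff_of_true ?_ hm
    have h1 : ε⁻¹ ≤ n := (Nat.le_ceil _).trans (by exact_mod_cast (Nat.le_succ _).trans hn)
    have hn0 : (0 : ℝ) < n := lt_of_lt_of_le (by positivity) h1
    refine ⟨_, smul_add_mem_of_le (convex_convexHull ℝ _) hvQ h (inv_nonneg.2 hn0.le) hε
      (inv_le_of_inv_le₀ hε h1), ?_⟩
    rw [hexp]
    simp only [smul_add, smul_smul, mul_inv_cancel₀ hn0.ne', one_smul]
    rw [add_comm]
  · refine Eventually.of_forall fun n => iff_of_false ?_ hm
    rintro ⟨x, hx, h⟩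
    refine hm ?_
    simp only [hexp] at h
    have h1 := real_smul_mem _ (Nat.cast_nonneg (α := ℝ) n)
      (sub_mem_span_of_mem_convexHull (latticeIncl M v) hx)
    rwa [smul_sub, h, add_sub_cancel_right] at h1

theorem coord_injective [Module.Free ℤ M] : Function.Injective
    fun (m : M) k => (Module.Free.chooseBasis ℤ M).coord k m := by
  intro x y h
  exact (Module.Free.chooseBasis ℤ M).ext_elem fun k => congrFun h k

variable [Module.Free ℤ M] [Module.Finite ℤ M]

/-- The multigraded Ehrhart series `∑ₙ (∑_{x ∈ nQ} x) tⁿ` over the group ring. -/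
noncomputable def multiSeries {Q : Set (ℝ ⊗[ℤ] M)} (hQ : IsLatticePolytope Q) :
    PowerSeries (AddMonoidAlgebra ℤ M) :=
  PowerSeries.mk fun n => ∑ x ∈ (latticePoints_finite hQ (n : ℝ)).toFinset,
    AddMonoidAlgebra.single x 1

theorem coeff_multiSeries {Q : Set (ℝ ⊗[ℤ] M)} (hQ : IsLatticePolytope Q) (n : ℕ) (m : M) :
    (PowerSeries.coeff n (multiSeries hQ)).coeff m =
      Set.indicator (latticePoints ((n : ℝ) • Q)) 1 m := by
  classical
  simp [multiSeries, AddMonoidAlgebra.coeff_sum, Finsupp.finsetSum_apply, Set.indicator_apply,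
    Finsupp.single_apply]

/-- The multigraded Ehrhart series has denominator `∏ (1 - x ^ v t)` over the vertices. -/
theorem exists_multiSeries_mul_eq {Q : Set (ℝ ⊗[ℤ] M)} (hQ : IsLatticePolytope Q) (V : Finset M)
    (hV : V.Nonempty) (hQV : Q = convexHull ℝ (latticeIncl M '' (V : Set M))) :
    ∃ N : (AddMonoidAlgebra ℤ M)[X], multiSeries hQ *
      ((∏ v ∈ V, fac v : (AddMonoidAlgebra ℤ M)[X]) : PowerSeries (AddMonoidAlgebra ℤ M)) = N := by
  classical
  let b := Module.Free.chooseBasis ℤ M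
  let i : M × ℤ →+ (ℝ ⊗[ℤ] M) × ℝ := (latticeIncl M).prodMap (Int.castAddHom ℝ)
  -- The index `none` carries the height, the others the coordinates in a basis of M.
  let φ : Option (Module.Free.ChooseBasisIndex ℤ M) → (ℝ ⊗[ℤ] M) × ℝ →ₗ[ℝ] ℝ := fun k =>
    k.elim (LinearMap.snd ℝ _ _) fun k => realForm (b.coord k) ∘ₗ LinearMap.fst ℝ _ _
  let ψ : Option (Module.Free.ChooseBasisIndex ℤ M) → M × ℤ → ℤ := fun k =>
    k.elim Prod.snd fun k p => b.coord k p.1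
  obtain ⟨F, hF⟩ := exists_eq_add_closure_of_cone i φ ψ
    (by
      rintro (_ | k) p
      · rfl
      · exact realForm_latticeIncl _ _)
    (by
      intro p q h
      refine Prod.ext (coord_injective (funext fun k => ?_)) (congrFun h none)
      exact congrFun h (some k))
    (V.image fun v => (v, (1 : ℤ)))
  obtain ⟨c, hc⟩ := exists_act_prod_binom_eq (V.image fun v => (v, (1 : ℤ))) F
  rw [← hF, Finset.prod_image (fun x _ y _ h => (Prod.ext_iff.1 h).1)] at hc
  refine exists_polynomial_of_coeffFun_eq _ c ?_
  rw [coeffFun_mul_prod_fac, ← hc]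
  congr 1
  funext ⟨m, k⟩
  have himg : i '' ((V.image fun v => (v, (1 : ℤ)) : Finset (M × ℤ)) : Set (M × ℤ)) =
      (fun w => (w, (1 : ℝ))) '' (latticeIncl M '' (V : Set M)) := by
    rw [Finset.coe_image, Set.image_image, Set.image_image]
    simp [i]
  have hmem : i (m, k) ∈ Submodule.span ℝ≥0 (i '' ((V.image fun v => (v, (1 : ℤ)) :
      Finset (M × ℤ)) : Set (M × ℤ))) ↔ 0 ≤ k ∧ latticeIncl M m ∈ (k : ℝ) • Q := by
    rw [himg, hQV]
    refine (mem_span_cone_iff (hV.to_set.image _) (latticeIncl M m) (k : ℝ)).trans ?_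
    rw [Int.cast_nonneg_iff]
  simp only [Set.indicator_apply, Set.mem_ofPred_eq, hmem, coeffFun, coeff_multiSeries]
  by_cases hk : 0 ≤ k
  · lift k to ℕ using hk
    simp only [latticePoints, Set.mem_ofPred_eq, Int.natCast_nonneg, Int.cast_natCast,
      Int.toNat_natCast, true_and, if_true]
    rfl
  · simp [hk]

/-- The generating function of the tangent cone at a vertex is a rational function whose
denominator is a product of binomials on which a generic linear form does not vanish. -/
theorem exists_act_tangent_cone_eq {Q : Set (ℝ ⊗[ℤ] M)} {l : Module.Dual ℤ M}
    (hgen : Genericity Q l) (V : Finset M)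
    (hQV : Q = convexHull ℝ (latticeIncl M '' (V : Set M))) {v : M}
    (hv : latticeIncl M v ∈ Q.extremePoints ℝ) :
    ∃ (H : Finset M) (g : AddMonoidAlgebra ℤ M), (∀ h ∈ H, l h ≠ 0) ∧
      act (∏ h ∈ H, binom h) (Set.indicator {m | latticeIncl M m ∈ Submodule.span ℝ≥0
        ((fun w => w - latticeIncl M v) '' (latticeIncl M '' (V : Set M)))} 1) = ⇑g.coeff := by
  classical
  have hv' := hv
  rw [hQV, ← Finset.coe_image] at hv'
  obtain ⟨G', hG', hspan, hedge⟩ := exists_edge_generators _ hv'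
  obtain ⟨G, hGV, rfl⟩ := Finset.subset_image_iff.1 hG'
  obtain ⟨F, hF⟩ := exists_eq_add_closure_of_cone (latticeIncl M)
    (fun k => realForm ((Module.Free.chooseBasis ℤ M).coord k)) _
    (fun k x => realForm_latticeIncl _ x) coord_injective (G.image fun w => w - v)
  obtain ⟨g, hg⟩ := exists_act_prod_binom_eq (G.image fun w => w - v) F
  have himg : latticeIncl M '' ((G.image fun w => w - v : Finset M) : Set M) =
      (fun w => w - latticeIncl M v) '' ((G.image (latticeIncl M) : Finset _) : Set _) := by
    rw [Finset.coe_image, Finset.coe_image, Set.image_image, Set.image_image]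
    simp
  refine ⟨G.image fun w => w - v, g, ?_, ?_⟩
  · intro h hh
    obtain ⟨w, hw, rfl⟩ := Finset.mem_image.1 hh
    -- The vector w - v may stop short of the end y of its edge, but y - v = s (w - v), so l (w - v)
    -- = 0 would contradict genericity.
    obtain ⟨y, hvy, hext, s, hs⟩ := hedge _ (Finset.mem_image_of_mem _ hw)
    rw [Finset.coe_image, ← hQV] at hext
    have hne := hgen _ _ ⟨hvy, hext⟩
    intro h0
    have h1 := congrArg (realForm l) hs
    rw [← map_sub, map_smul, realForm_latticeIncl, h0, map_sub, Int.cast_zero, smul_zero,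
      sub_eq_zero] at h1
    exact hne h1.symm
  · rw [← hg, ← hF, himg, hspan, Finset.coe_image]

end Assembly

/-! ### Specialization to q and reduction of the fraction. -/

section Specialization

/-- D = ∏ f k ^ (multiplicity of k - 1) collects the repetitions. The same D serves the products
missing an index v, since both sides then lose exactly one f (j v). -/
theorem exists_common_factor {ι κ R : Type*} [DecidableEq ι] [DecidableEq κ] [CommRing R]
    [IsDomain R] (V : Finset ι) (j : ι → κ) (f : κ → R) (hf : ∀ k, f k ≠ 0) :
    ∃ D : R, D ≠ 0 ∧ ∏ w ∈ V, f (j w) = D * ∏ k ∈ V.image j, f k ∧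
      ∀ v ∈ V, ∏ w ∈ V.erase v, f (j w) = D * ∏ k ∈ (V.image j).erase (j v), f k := by
  have hprod : ∏ w ∈ V, f (j w) =
      (∏ k ∈ V.image j, f k ^ ((V.filter fun w => j w = k).card - 1)) * ∏ k ∈ V.image j, f k := by
    rw [Finset.prod_comp, ← Finset.prod_mul_distrib]
    refine Finset.prod_congr rfl fun k hk => ?_
    rw [← pow_succ, Nat.sub_add_cancel]
    obtain ⟨w, hw, rfl⟩ := Finset.mem_image.1 hk
    exact Finset.card_pos.2 ⟨w, by simpa using hw⟩
  refine ⟨_, Finset.prod_ne_zero_iff.2 fun k _ => pow_ne_zero _ (hf k), hprod, fun v hv => ?_⟩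
  refine mul_left_cancel₀ (hf (j v)) ?_
  rw [Finset.mul_prod_erase V (fun w => f (j w)) hv, hprod, mul_left_comm,
    Finset.mul_prod_erase _ f (Finset.mem_image_of_mem j hv)]

/-- Simple poles survive specialization: if several factors `f (j w)` become equal, a sum of
partial fractions still has a denominator without multiplicities. -/
theorem exists_mul_prod_image_eq {ι κ R : Type*} [DecidableEq ι] [DecidableEq κ] [CommRing R]
    [IsDomain R] (V : Finset ι) (j : ι → κ) (f : κ → R[X]) (hf : ∀ k, f k ≠ 0)
    (E : PowerSeries R) (N U : R[X]) (c : ι → R) (p : R)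
    (hN : E * ((∏ w ∈ V, f (j w) : R[X]) : PowerSeries R) = N)
    (hU : Polynomial.C p * N =
      U * ∏ w ∈ V, f (j w) + ∑ v ∈ V, Polynomial.C (c v) * ∏ w ∈ V.erase v, f (j w)) :
    ∃ Y : R[X], PowerSeries.C p * (E * ((∏ k ∈ V.image j, f k : R[X]) : PowerSeries R)) = Y := by
  obtain ⟨D, hD, hVD, hVD'⟩ := exists_common_factor V j f hf
  refine ⟨U * ∏ k ∈ V.image j, f k +
    ∑ v ∈ V, Polynomial.C (c v) * ∏ k ∈ (V.image j).erase (j v), f k, ?_⟩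
  have hD' : (D : PowerSeries R) ≠ 0 := by
    rwa [Ne, Polynomial.coe_eq_zero_iff]
  have h1 : Polynomial.C p * N = D * (U * ∏ k ∈ V.image j, f k +
      ∑ v ∈ V, Polynomial.C (c v) * ∏ k ∈ (V.image j).erase (j v), f k) := by
    rw [hU, hVD, mul_add, Finset.mul_sum, mul_left_comm]
    congr 1
    refine Finset.sum_congr rfl fun v hv => ?_
    rw [hVD' v hv, mul_left_comm]
  refine mul_left_cancel₀ hD' ?_
  rw [← Polynomial.coe_mul D, ← h1, Polynomial.coe_mul, Polynomial.coe_C, ← hN, hVD,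
    Polynomial.coe_mul]
  ring

/-- The factor is linear in t with constant term 1, hence primitive. -/
theorem irreducible_one_sub (j : ℕ) :
    Irreducible (1 - Polynomial.X * Polynomial.C (Polynomial.X ^ j) : ℤ[X][X]) := by
  have h := Polynomial.irreducible_C_mul_X_add_C (R := ℤ[X]) (a := -Polynomial.X ^ j) (b := 1)
    (by simp) isRelPrime_one_right
  have h2 : (1 - Polynomial.X * Polynomial.C (Polynomial.X ^ j) : ℤ[X][X]) =
      Polynomial.C (-Polynomial.X ^ j) * Polynomial.X + Polynomial.C 1 := by
    rw [Polynomial.C_neg, Polynomial.C_1]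
    ring
  rwa [h2]

/-- Cancelling the common factors of a fraction with denominator `∏ (1 - t q ^ j)`. -/
theorem exists_reduced_fraction (E : PowerSeries ℤ[X]) (S₀ : Finset ℕ) (P₀ : ℤ[X][X])
    (h : E * (denominator S₀ : PowerSeries ℤ[X]) = P₀) :
    ∃ S ⊆ S₀, ∃ P : ℤ[X][X], E * (denominator S : PowerSeries ℤ[X]) = P ∧
      IsRelPrime P (denominator S) := by
  classical
  obtain ⟨S, hS, hmin⟩ := Finset.exists_min_image
    (S₀.powerset.filter fun S => ∃ P : ℤ[X][X], E * (denominator S : PowerSeries ℤ[X]) = P)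
    Finset.card ⟨S₀, by simpa using ⟨P₀, h⟩⟩
  simp only [Finset.mem_filter, Finset.mem_powerset] at hS hmin
  obtain ⟨hSS, P, hP⟩ := hS
  refine ⟨S, hSS, P, hP, IsRelPrime.prod_right fun j hj => ?_⟩
  refine ((irreducible_one_sub j).isRelPrime_iff_not_dvd.2 ?_).symm
  rintro ⟨P', hP'⟩
  -- A factor dividing P could be cancelled in the domain ℤ[q][[t]], contradicting the minimality of
  -- S.
  refine absurd (hmin (S.erase j) ⟨(Finset.erase_subset _ _).trans hSS, P', ?_⟩)
    (not_le.2 (Finset.card_erase_lt_of_mem hj))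
  have hne : ((1 - Polynomial.X * Polynomial.C (Polynomial.X ^ j) : ℤ[X][X]) :
      PowerSeries ℤ[X]) ≠ 0 := by
    rw [Ne, Polynomial.coe_eq_zero_iff]
    exact (irreducible_one_sub j).ne_zero
  refine mul_left_cancel₀ hne ?_
  rw [← Polynomial.coe_mul, ← hP', ← hP, mul_left_comm, ← Polynomial.coe_mul, denominator,
    denominator,
    Finset.mul_prod_erase S (fun j => 1 - Polynomial.X * Polynomial.C (Polynomial.X ^ j)) hj]

variable {M : Type*} [AddCommGroup M]

/-- The specialization `x ↦ q ^ l x` of the group ring. -/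
noncomputable def spec (l : Module.Dual ℤ M) : AddMonoidAlgebra ℤ M →+* LaurentPolynomial ℤ :=
  AddMonoidAlgebra.mapDomainRingHom ℤ l.toAddMonoidHom

theorem spec_single (l : Module.Dual ℤ M) (m : M) :
    spec l (AddMonoidAlgebra.single m 1) = LaurentPolynomial.T (l m) := by
  exact AddMonoidAlgebra.mapDomain_single

theorem spec_binom_ne_zero (l : Module.Dual ℤ M) {m : M} (h : l m ≠ 0) :
    spec l (binom m) ≠ 0 := by
  rw [binom, map_sub, map_one, spec_single, sub_ne_zero, ← LaurentPolynomial.T_zero]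
  intro h'
  exact h (AddMonoidAlgebra.single_left_injective (one_ne_zero (α := ℤ)) h').symm

/-- The factor `1 - q ^ k t` with Laurent polynomial coefficients. -/
noncomputable def laurentFac (k : ℤ) : (LaurentPolynomial ℤ)[X] :=
  1 - Polynomial.C (LaurentPolynomial.T k) * Polynomial.X

theorem laurentFac_ne_zero (k : ℤ) : laurentFac k ≠ 0 := by
  intro h
  have := congrArg (Polynomial.coeff · 0) h
  simp [laurentFac] at this

theorem map_fac (l : Module.Dual ℤ M) (v : M) : (fac v).map (spec l) = laurentFac (l v) := by
  simp [fac, laurentFac, spec_single]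

theorem map_denominator (S : Finset ℕ) :
    (denominator S).map Polynomial.toLaurent = ∏ j ∈ S, laurentFac (j : ℤ) := by
  rw [denominator, Polynomial.map_prod]
  refine Finset.prod_congr rfl fun j _ => ?_
  rw [laurentFac, mul_comm, Polynomial.map_sub, Polynomial.map_one, Polynomial.map_mul,
    Polynomial.map_C, Polynomial.map_X, Polynomial.toLaurent_X_pow]

theorem exists_isGreatest_realForm (l : Module.Dual ℤ M) (V : Finset M) (hV : V.Nonempty) :
    ∃ m : ℝ, IsGreatest (realForm l '' convexHull ℝ (latticeIncl M '' (V : Set M))) m ∧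
      ∀ v ∈ V, (l v : ℝ) ≤ m := by
  obtain ⟨v, hv, hmax⟩ := Finset.exists_max_image V (fun v => (l v : ℝ)) hV
  refine ⟨l v, ⟨⟨_, subset_convexHull _ _ ⟨v, hv, rfl⟩, realForm_latticeIncl l v⟩, ?_⟩, hmax⟩
  rintro _ ⟨x, hx, rfl⟩
  refine convexHull_min (t := realForm l ⁻¹' Set.Iic (l v : ℝ)) ?_
    ((convex_Iic _).linear_preimage _) hx
  rintro _ ⟨w, hw, rfl⟩
  rw [Set.mem_preimage, realForm_latticeIncl]
  exact hmax w hw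

variable [Module.Free ℤ M] [Module.Finite ℤ M]

/-- Positivity makes the truncation `toNat` in the exponents harmless. -/
theorem map_multiSeries {Q : Set (ℝ ⊗[ℤ] M)} (hQ : IsLatticePolytope Q) {l : Module.Dual ℤ M}
    (hpos : Positivity Q l) : PowerSeries.map (spec l) (multiSeries hQ) =
      PowerSeries.map Polynomial.toLaurent (ehrhartSeries Q l) := by
  ext1 n
  rw [PowerSeries.coeff_map, PowerSeries.coeff_map, multiSeries, ehrhartSeries,
    PowerSeries.coeff_mk, PowerSeries.coeff_mk, weightedSum,
    finsum_mem_eq_finite_toFinset_sum _ (latticePoints_finite hQ _), map_sum, map_sum]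
  refine Finset.sum_congr rfl fun x hx => ?_
  rw [spec_single, Polynomial.toLaurent_X_pow, Int.toNat_of_nonneg
    (nonneg_of_mem hQ hpos n ((Set.Finite.mem_toFinset _).1 hx))]

/-- The `q`-Ehrhart series of a lattice polytope has the denominator `∏ (1 - t q ^ j)`, the product
being over the values of the form at the vertices, without multiplicities. -/
theorem exists_ehrhartSeries_mul_eq {Q : Set (ℝ ⊗[ℤ] M)} {l : Module.Dual ℤ M}
    (hQ : IsLatticePolytope Q) (hpos : Positivity Q l) (hgen : Genericity Q l) (V : Finset M)
    (hV : V.Nonempty) (hQV : Q = convexHull ℝ (latticeIncl M '' (V : Set M)))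
    (hext : ∀ v ∈ V, latticeIncl M v ∈ Q.extremePoints ℝ) :
    ∃ P : ℤ[X][X], ehrhartSeries Q l *
      (denominator (V.image fun v => (l v).toNat) : PowerSeries ℤ[X]) = P := by
  classical
  obtain ⟨N, hN⟩ := exists_multiSeries_mul_eq hQ V hV hQV
  have hcone := fun v (hv : v ∈ V) => exists_act_tangent_cone_eq hgen V hQV (hext v hv)
  choose! H g hH hg using hcone
  obtain ⟨U, c, hU⟩ := exists_partial_fractions hN
    (fun v => Set.indicator {m | latticeIncl M m ∈ Submodule.span NNReal
        ((fun w => w - latticeIncl M v) '' (latticeIncl M '' (V : Set M)))} 1) (fun v hv m => by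
    filter_upwards [eventually_mem_dilate_iff V hv m] with n hn
    rw [← hQV] at hn
    simp only [coeff_multiSeries, Set.indicator_apply, Set.mem_ofPred_eq, hn]
    rfl) (fun v => ∏ h ∈ H v, binom h) g hg
  have hl : ∀ v ∈ V, ((l v).toNat : ℤ) = l v := by
    intro v hv
    have h1 := hpos _ (hext v hv)
    rw [realForm_latticeIncl] at h1
    exact Int.toNat_of_nonneg (by exact_mod_cast h1)
  have hmap : ∀ W ⊆ V, (∏ w ∈ W, fac w).map (spec l) =
      ∏ w ∈ W, laurentFac ((l w).toNat : ℤ) := by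
    intro W hW
    rw [Polynomial.map_prod]
    refine Finset.prod_congr rfl fun w hw => ?_
    rw [map_fac, hl w (hW hw)]
  have hp0 : spec l (∏ v ∈ V, ∏ h ∈ H v, binom h) ≠ 0 := by
    rw [map_prod, Finset.prod_ne_zero_iff]
    intro v hv
    rw [map_prod, Finset.prod_ne_zero_iff]
    exact fun h hh => spec_binom_ne_zero l (hH v hv h hh)
  obtain ⟨Y, hY⟩ := exists_mul_prod_image_eq V (fun v => (l v).toNat)
    (fun j : ℕ => laurentFac (j : ℤ)) (fun k => laurentFac_ne_zero k)
    (PowerSeries.map (spec l) (multiSeries hQ)) (N.map (spec l)) (U.map (spec l))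
    (fun v => spec l (c v)) (spec l (∏ v ∈ V, ∏ h ∈ H v, binom h))
    (by
      rw [← hmap V subset_rfl, Polynomial.polynomial_map_coe, Polynomial.polynomial_map_coe, ← hN,
        map_mul])
    (by
      rw [← Polynomial.map_C, ← Polynomial.map_mul, hU, Polynomial.map_add, Polynomial.map_mul,
        hmap V subset_rfl, Polynomial.map_sum]
      congr 1
      refine Finset.sum_congr rfl fun v _ => ?_
      rw [Polynomial.map_mul, Polynomial.map_C, hmap _ (Finset.erase_subset _ _)])
  rw [map_multiSeries hQ hpos, ← map_denominator, Polynomial.polynomial_map_coe, ← map_mul] at hY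
  -- Beyond the degree of Y, each coefficient is annihilated by the nonzero Laurent polynomial ∏
  -- p_v, hence is 0; no division by it is needed.
  refine exists_polynomial_eq _ (Y.natDegree + 1) fun n hn => ?_
  have h := congrArg (PowerSeries.coeff n) hY
  rw [PowerSeries.coeff_C_mul, PowerSeries.coeff_map, Polynomial.coeff_coe,
    Polynomial.coeff_eq_zero_of_natDegree_lt hn] at h
  exact Polynomial.toLaurent_eq_zero.1 ((mul_eq_zero.1 h).resolve_left hp0)

end Specialization

end QEhrhart

theorem proposition1p1 {M : Type*} [AddCommGroup M] [Module.Free ℤ M] [Module.Finite ℤ M]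
    (Q : Set (ℝ ⊗[ℤ] M)) (l : Module.Dual ℤ M)
    (hQ : QEhrhart.IsLatticePolytope Q)
    (hpos : QEhrhart.Positivity Q l) (hgen : QEhrhart.Genericity Q l) :
    ∃ (S : Finset ℕ) (P : ℤ[X][X]) (m : ℝ),
      QEhrhart.ehrhartSeries Q l * (QEhrhart.denominator S : PowerSeries ℤ[X])
        = (P : PowerSeries ℤ[X]) ∧
      IsRelPrime P (QEhrhart.denominator S) ∧
      IsGreatest (QEhrhart.realForm l '' Q) m ∧
      (∀ j ∈ S, (j : ℝ) ≤ m) ∧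
      (∀ j ∈ S, ∃ v ∈ Q.extremePoints ℝ, QEhrhart.realForm l v = (j : ℝ)) := by
  obtain ⟨V, hV, hQV, hext⟩ := QEhrhart.exists_vertices hQ
  obtain ⟨P₀, hP₀⟩ := QEhrhart.exists_ehrhartSeries_mul_eq hQ hpos hgen V hV hQV hext
  obtain ⟨S, hS, P, hP, hrel⟩ := QEhrhart.exists_reduced_fraction _ _ _ hP₀
  obtain ⟨m, hm, hle⟩ := QEhrhart.exists_isGreatest_realForm l V hV
  have hvert : ∀ j ∈ S, ∃ v ∈ V, (l v : ℝ) = j := by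
    intro j hj
    obtain ⟨v, hv, rfl⟩ := Finset.mem_image.1 (hS hj)
    have h1 := hpos _ (hext v hv)
    rw [QEhrhart.realForm_latticeIncl] at h1
    have h2 : ((l v).toNat : ℤ) = l v := Int.toNat_of_nonneg (by exact_mod_cast h1)
    exact ⟨v, hv, by exact_mod_cast h2.symm⟩
  refine ⟨S, P, m, hP, hrel, hQV ▸ hm, fun j hj => ?_, fun j hj => ?_⟩
  · obtain ⟨v, hv, h⟩ := hvert j hj
    exact h ▸ hle v hv
  · obtain ⟨v, hv, h⟩ := hvert j hj
    exact ⟨_, hext v hv, (QEhrhart.realForm_latticeIncl l v).trans h⟩
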